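/- Setting. Let $M=M^3(G)$ be a finite simplicial complex, $G=\pi_1M$, presented as a finite union of simply connected subcomplexes $\Delta_i$ (the pieces) glued together along finitely many path-connected subcomplexes (the faces): every face $\gamma$ is a common subcomplex of two distinct pieces, and $M$ is the quotient of the disjoint union of the $\Delta_i$ obtained by identifying the two copies of each face. Choose a set $T$ of faces which are the edges of a spanning tree of the graph with the pieces as vertices and the faces as edges, and let the fundamental domain $\Delta$ be the arborescent union of the pieces obtained from their disjoint union by gluing along the faces in $T$ only. Let $\Sigma$ be the set of free faces of $\Delta$, namely the two copies of each face not in $T$, and let $j:\Sigma\to\Sigma$ be the fixed point free involution which exchanges the two copies of the same face. Let $\overline G$ be the free group generated by the symbols $\overline g\in\Sigma$ subject to $\overline g\cdot j\overline g=1$. Let $X$ be the quotient of the disjoint union $\bigsqcup_{x\in\overline G}x\Delta$ obtained by gluing $x\Delta$ to $x\overline g\Delta$, for all $x\in\overline G$ and $\overline g\in\Sigma$, along their faces $x\Delta\supset\overline g\leftrightarrow j\overline g\subset x\overline g\Delta$, with the quotient (weak) topology, and let $F:X\to M$ be the tautological map. In the paper $M$, the pieces and the faces, and $X=X^3$, are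 $3$-dimensional; no restriction on the dimension is needed. An equivalence relation $R$ on $X$ contained in $\Phi(F)=\{(x_1,x_2):F(x_1)=F(x_2)\}$ is called $F$-admissible if, whenever two simplices $\sigma_1,\sigma_2$ of $X$ have the same image under $F$ and $R$ relates some $x_1\in\operatorname{int}\sigma_1$ and $x_2\in\operatorname{int}\sigma_2$ with $F(x_1)=F(x_2)$, then $R$ relates all $y_1\in\sigma_1$ and $y_2\in\sigma_2$ with $F(y_1)=F(y_2)$. It kills the singularities if the induced map $X/R\to M$ is immersive, i.e. every point of $X/R$ has a neighbourhood on which this map is injective. Let $\Psi(F)$ be the intersection of all $F$-admissible equivalence relations contained in $\Phi(F)$ which kill the singularities. Lemma. $\Psi(F)$ is the smallest $F$-admissible equivalence relation contained in $\Phi(F)$ which kills the singularities (in particular it has these properties itself), and the induced map $F_1:X/\Psi(F)\to M$ is the universal covering of $M$: it is a surjective covering map and $X/\Psi(F)$ is simply connected. -/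

import Mathlib

open Topology Geometry

noncomputable section

namespace Zipping

/-! ### Equivalence relations on the source of a map of complexes -/

section PhiPsi

variable {X Y J : Type*} [TopologicalSpace X]

/-- The singularities of `f`: the points in no neighbourhood of which `f` is injective. The map is
*immersive* when there are none. -/
def Sing (f : X → Y) : Set X :=
  {x | ∀ U ∈ 𝓝 x, ¬ Set.InjOn f U}

/-- The equivalence relation `Φ(f)`: `x₁ ~ x₂` if and only if `f x₁ = f x₂`. -/
def Phi (f : X → Y) : Setoid X := Setoid.ker f

/-- The map `f₁(R) : X/R → Y` induced by `f`, for an equivalence relation `R ⊆ Φ(f)`. -/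
def descend (f : X → Y) (R : Setoid X) (h : R ≤ Phi f) : Quotient R → Y :=
  Quotient.lift f fun _ _ hab => h hab

/-- `R` is `f`-admissible, where `cell` and `cellInt` are the closed simplices of `X` and their
interiors: if two simplices have the same image under `f` and if `R` relates two of their interior
points which have the same image, then `R` identifies the two simplices (compatibly with `f`).
For a map which is injective on the simplices, two simplices with the same image have the same
dimension. -/
def Admissible (f : X → Y) (cell cellInt : J → Set X) (R : Setoid X) : Prop :=
  ∀ a b : J, f '' cell a = f '' cell b →
    (∃ x₁ ∈ cellInt a, ∃ x₂ ∈ cellInt b, f x₁ = f x₂ ∧ R x₁ x₂) →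
      ∀ y₁ ∈ cell a, ∀ y₂ ∈ cell b, f y₁ = f y₂ → R y₁ y₂

/-- The `f`-admissible equivalence relations `R ⊆ Φ(f)` which kill all the singularities:
`f₁(R) : X/R → Y` is immersive (`X/R` has the quotient topology). -/
def KillingRelations (f : X → Y) (cell cellInt : J → Set X) : Set (Setoid X) :=
  {R | Admissible f cell cellInt R ∧ ∃ h : R ≤ Phi f, Sing (descend f R h) = ∅}

/-- The equivalence relation `Ψ(f)`: the smallest `f`-admissible equivalence relation contained in
`Φ(f)` which kills all the singularities of `f`. -/
def Psi (f : X → Y) (cell cellInt : J → Set X) : Setoid X :=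
  sInf (KillingRelations f cell cellInt)

theorem phi_mem_killingRelations (f : X → Y) (cell cellInt : J → Set X) :
    Phi f ∈ KillingRelations f cell cellInt := by
  refine ⟨fun _ _ _ _ y₁ _ y₂ _ h => h, le_rfl, ?_⟩
  refine Set.eq_empty_iff_forall_notMem.2 fun x hx => hx Set.univ Filter.univ_mem ?_
  rintro ⟨a⟩ - ⟨b⟩ - hab
  exact Quotient.sound hab

theorem psi_le_phi (f : X → Y) (cell cellInt : J → Set X) : Psi f cell cellInt ≤ Phi f :=
  sInf_le (phi_mem_killingRelations f cell cellInt)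

end PhiPsi

/-- `p` is a universal covering: a surjective covering map with simply connected total space. -/
def IsUniversalCovering {A B : Type*} [TopologicalSpace A] [TopologicalSpace B] (p : A → B) :
    Prop :=
  IsCoveringMap p ∧ Function.Surjective p ∧ SimplyConnectedSpace A

/-- The interior of the simplex with vertices `s`. -/
def openSimplex {E : Type*} [AddCommGroup E] [Module ℝ E] (s : Finset E) : Set E :=
  convexHull ℝ (s : Set E) \ ⋃ t : Finset E, ⋃ _ : t ⊂ s, convexHull ℝ (t : Set E)

/-! ### Complexes decomposed into pieces glued along faces -/

/-- A decomposition of the simplicial complex `M` into simply connected subcomplexes (the pieces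
`Δᵢ`), glued together along connected subcomplexes (the faces). Each face `γ` is common to two
distinct pieces, its two sides `side γ false` and `side γ true`. -/
structure PieceDecomposition {E : Type*} [NormedAddCommGroup E] [NormedSpace ℝ E]
    (M : SimplicialComplex ℝ E) (ι Γ : Type*) where
  /-- the pieces `Δᵢ` -/
  piece : ι → SimplicialComplex ℝ E
  /-- the common faces -/
  face : Γ → SimplicialComplex ℝ E
  /-- the two pieces to which a face belongs -/
  side : Γ → Bool → ι
  side_ne : ∀ γ, side γ false ≠ side γ true
  piece_le : ∀ i, piece i ≤ M
  face_le : ∀ γ b, face γ ≤ piece (side γ b)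
  /-- `M` is the union of the pieces -/
  cover : ∀ s ∈ M.faces, ∃ i, s ∈ (piece i).faces
  piece_simplyConnected : ∀ i, SimplyConnectedSpace (piece i).space
  face_connected : ∀ γ, IsPathConnected (face γ).space
  /-- `M` is obtained from the disjoint union of the pieces by identifying the two copies of each
  face: the copies in two pieces of one point of `M` are related by a chain of these
  identifications. -/
  glued : ∀ i k, ∀ p ∈ (piece i).space ∩ (piece k).space,
    Relation.ReflTransGen
      (fun a b => ∃ γ c, a = side γ c ∧ b = side γ (!c) ∧ p ∈ (face γ).space) i k

namespace PieceDecomposition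

variable {E : Type*} [NormedAddCommGroup E] [NormedSpace ℝ E] {M : SimplicialComplex ℝ E}
  {ι Γ : Type*} (D : PieceDecomposition M ι Γ) (T : Set Γ)

/-- The faces in `T` are those of an arborescent union of all the pieces: they are the edges
of a spanning tree of the graph with the pieces as vertices and the faces as edges. -/
def IsArborescent : Prop :=
  Set.InjOn (fun γ => s(D.side γ false, D.side γ true)) T ∧
    (SimpleGraph.fromEdgeSet ((fun γ => s(D.side γ false, D.side γ true)) '' T)).IsTree

/-- The gluings of the pieces along the faces in `T`. -/
inductive DomainRel : (Σ i, (D.piece i).space) → (Σ i, (D.piece i).space) → Prop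
  | glue (γ : Γ) (hγ : γ ∈ T) (p : E) (hf : p ∈ (D.face γ).space)
      (h₀ : p ∈ (D.piece (D.side γ false)).space) (h₁ : p ∈ (D.piece (D.side γ true)).space) :
      DomainRel ⟨D.side γ false, ⟨p, h₀⟩⟩ ⟨D.side γ true, ⟨p, h₁⟩⟩

/-- The fundamental domain `Δ`: the pieces glued along the faces in `T`. -/
def Domain : Type _ := Quot (D.DomainRel T)

instance : TopologicalSpace (D.Domain T) :=
  inferInstanceAs (TopologicalSpace (Quot (D.DomainRel T)))

/-- The point of the fundamental domain given by a point of a piece. -/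
def toDomain (i : ι) (p : (D.piece i).space) : D.Domain T := Quot.mk _ ⟨i, p⟩

/-- The group `Ḡ`. The free faces of the fundamental domain are the pairs `(γ, b)` with `γ ∉ T`,
namely the copy of `γ` in the piece `side γ b`; the involution `j` is `(γ, b) ↦ (γ, !b)`. The free
monoid on these symbols, with the relations `g * j g = 1`, is the free group on the faces `γ ∉ T`,
where `(γ, true)` is a generator and `(γ, false)` its inverse. -/
abbrev GBar : Type _ := FreeGroup {γ : Γ // γ ∉ T}

/-- The element of `Ḡ` given by the free face `(γ, b)`. -/
def gen (γ : {γ : Γ // γ ∉ T}) (b : Bool) : GBar T := FreeGroup.mk [(γ, b)]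

/-- The gluings of the copies of the fundamental domain: the copy of index `x` is glued along its
free face `g = (γ, b)` to the free face `j g = (γ, !b)` of the copy of index `x * g`. -/
inductive TotalRel : (Σ _ : GBar T, D.Domain T) → (Σ _ : GBar T, D.Domain T) → Prop
  | glue (x : GBar T) (γ : {γ : Γ // γ ∉ T}) (b : Bool) (p : E) (hf : p ∈ (D.face γ).space)
      (h₀ : p ∈ (D.piece (D.side γ b)).space) (h₁ : p ∈ (D.piece (D.side γ (!b))).space) :
      TotalRel ⟨x, D.toDomain T (D.side γ b) ⟨p, h₀⟩⟩
        ⟨x * gen T γ b, D.toDomain T (D.side γ (!b)) ⟨p, h₁⟩⟩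

/-- The space `X`: the arborescent union of the copies `xΔ`, `x ∈ Ḡ`, of the fundamental domain,
with the quotient (that is, weak) topology. -/
def Total : Type _ := Quot (D.TotalRel T)

instance : TopologicalSpace (D.Total T) :=
  inferInstanceAs (TopologicalSpace (Quot (D.TotalRel T)))

/-- The point of `X` given by a point of a piece of the copy of index `x`. -/
def toTotal (x : GBar T) (i : ι) (p : (D.piece i).space) : D.Total T :=
  Quot.mk _ ⟨x, D.toDomain T i p⟩

theorem piece_space_subset (i : ι) : (D.piece i).space ⊆ M.space := fun _ hp => by
  obtain ⟨s, hs, hps⟩ := SimplicialComplex.mem_space_iff.1 hp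
  exact SimplicialComplex.mem_space_iff.2 ⟨s, D.piece_le i hs, hps⟩

/-- The quotient map from the fundamental domain to `M`. -/
def domainMap : D.Domain T → M.space :=
  Quot.lift (fun q => ⟨q.2.1, D.piece_space_subset q.1 q.2.2⟩) (by rintro _ _ ⟨⟩; rfl)

/-- The tautological map `F : X → M`. -/
def F : D.Total T → M.space :=
  Quot.lift (fun q => D.domainMap T q.2) (by rintro _ _ ⟨⟩; rfl)

/-- The simplices of `X` are indexed by an element of `Ḡ`, a piece, and a simplex of the piece
(a simplex lying in several pieces has several indices). -/
abbrev CellIndex : Type _ := GBar T × Σ i, (D.piece i).faces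

/-- The closed simplices of `X`. -/
def cell (a : D.CellIndex T) : Set (D.Total T) :=
  {y | ∃ p : (D.piece a.2.1).space,
    p.1 ∈ convexHull ℝ (a.2.2.1 : Set E) ∧ D.toTotal T a.1 a.2.1 p = y}

/-- The interiors of the simplices of `X`. -/
def cellInt (a : D.CellIndex T) : Set (D.Total T) :=
  {y | ∃ p : (D.piece a.2.1).space,
    p.1 ∈ openSimplex a.2.2.1 ∧ D.toTotal T a.1 a.2.1 p = y}

/-- The equivalence relation `Ψ(F)` on `X`. -/
def PsiF : Setoid (D.Total T) := Psi (D.F T) (D.cell T) (D.cellInt T)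

/-- The induced map `F₁ : X/Ψ(F) → M`. -/
def F₁ : Quotient (D.PsiF T) → M.space :=
  descend (D.F T) (D.PsiF T) (psi_le_phi (D.F T) (D.cell T) (D.cellInt T))

end PieceDecomposition

end Zipping

end

noncomputable section

namespace Zipping

/-! ### Open simplices and stars in a finite complex -/

section Simplices

variable {E : Type*} [NormedAddCommGroup E] [NormedSpace ℝ E] {M K : SimplicialComplex ℝ E}

/-! The relation `Ψ(F)` can be written down explicitly. Crossing a face translates the index `x` of
a copy by an element `label` of `Ḡ`, so a closed chain of faces through a point `p` returns to the
same piece with `x` replaced by `x * w`, where `w` is the product of the labels. Let `N` be the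
normal closure of all these `w` (`chainSubgroup`). Modulo `N`, the translation between two pieces
containing `p` no longer depends on the chain (`transition`) and satisfies a cocycle law. Two points
of `X` over the same `p` are related by `deckRel` when their indices match under this translation in
`Ḡ/N`.

Minimality: let `R` be admissible and kill the singularities. In a given piece, the points at which
`R` identifies two copies form an open set (immersivity) which is also closed (admissibility and
finiteness). Pieces being connected, this set is empty or everything, and identifications pass
through faces. The translations trivial for `R` thus form a normal subgroup containing the closed
chains, hence `N`, so `deckRel ≤ R` (`deckRel_le`).

Covering: over a small ball around `m`, every chain through a point of the ball is also a chain
through `m`, so the index in `Ḡ/N`, referred to `m`, trivializes `X/deckRel`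
(`isCoveringMap_deckProj`). In particular `deckRel` kills the singularities.

Simple connectivity, in the spirit of van Kampen: crossing the faces defines a homomorphism from `Ḡ`
to the fundamental group of `M`, which kills `N`. It attaches to each point of `X/deckRel` a
homotopy class of paths in `M` from its image to a root, compatibly with paths (`exists_deckHom`,
`mk_map_comp_eq`). Two paths with the same ends therefore have homotopic images in `M`, and
coverings are injective on homotopy classes of paths. -/

theorem exists_subset_mem_openSimplex (s : Finset E) {p : E}
    (hp : p ∈ convexHull ℝ (s : Set E)) : ∃ t ⊆ s, p ∈ openSimplex t := by
  induction s using Finset.strongInduction with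
  | H s ih =>
    by_cases h : p ∈ openSimplex s
    · exact ⟨s, subset_rfl, h⟩
    · have h' : ∃ t : Finset E, t ⊂ s ∧ p ∈ convexHull ℝ (t : Set E) := by
        by_contra! hn
        refine h ⟨hp, ?_⟩
        simpa using hn
      obtain ⟨t, hts, hpt⟩ := h'
      obtain ⟨u, hut, hu⟩ := ih t hts hpt
      exact ⟨u, hut.trans hts.1, hu⟩

theorem exists_face_mem_openSimplex {p : E} (hp : p ∈ K.space) :
    ∃ s ∈ K.faces, p ∈ openSimplex s := by
  obtain ⟨s, hs, hps⟩ := SimplicialComplex.mem_space_iff.1 hp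
  obtain ⟨t, hts, ht⟩ := exists_subset_mem_openSimplex s hps
  refine ⟨t, K.down_closed hs hts ?_, ht⟩
  have : (convexHull ℝ (t : Set E)).Nonempty := ⟨p, ht.1⟩
  simpa using this

/-- Two simplices meet in the hull of their common vertices; if `s ∩ t` were a proper subset of `s`,
then `p` would lie on the boundary of `s`. -/
theorem subset_of_mem_openSimplex {s t : Finset E} (hs : s ∈ M.faces) (ht : t ∈ M.faces) {p : E}
    (hp : p ∈ openSimplex s) (hpt : p ∈ convexHull ℝ (t : Set E)) : s ⊆ t := by
  classical
  by_contra hst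
  have h : p ∈ convexHull ℝ ((s ∩ t : Finset E) : Set E) := by
    rw [Finset.coe_inter]
    exact M.inter_subset_convexHull hs ht ⟨hp.1, hpt⟩
  refine hp.2 ?_
  simp only [Set.mem_iUnion]
  exact ⟨s ∩ t, ⟨Finset.inter_subset_left, fun h' => hst fun a ha =>
    (Finset.mem_inter.1 (h' ha)).2⟩, h⟩

theorem convexHull_subset_space_of_mem_openSimplex {s : Finset E} (hs : s ∈ M.faces) (hK : K ≤ M)
    {p : E} (hp : p ∈ openSimplex s) (hpK : p ∈ K.space) :
    convexHull ℝ (s : Set E) ⊆ K.space := by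
  obtain ⟨t, ht, hpt⟩ := SimplicialComplex.mem_space_iff.1 hpK
  refine (convexHull_mono ?_).trans (K.convexHull_subset_space ht)
  exact_mod_cast subset_of_mem_openSimplex hs (hK ht) hp hpt

theorem isClosed_convexHull_finset (s : Finset E) : IsClosed (convexHull ℝ (s : Set E)) :=
  (s.finite_toSet.isCompact_convexHull ℝ).isClosed

theorem isClosed_space (hK : K.faces.Finite) : IsClosed K.space :=
  hK.isClosed_biUnion fun s _ => isClosed_convexHull_finset s

/-- Small balls around a point of a finite complex meet only the simplices through the point. -/
def IsStarRadius (M : SimplicialComplex ℝ E) (m : E) (ε : ℝ) : Prop :=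
  ∀ s ∈ M.faces, ∀ q ∈ Metric.ball m ε, q ∈ convexHull ℝ (s : Set E) →
    m ∈ convexHull ℝ (s : Set E)

/-- The finitely many simplices avoiding `m` have a closed union, so some ball around `m` misses it.
-/
theorem exists_isStarRadius (hM : M.faces.Finite) (m : E) : ∃ ε > 0, IsStarRadius M m ε := by
  have h : IsOpen (⋃ s ∈ {s ∈ M.faces | m ∉ convexHull ℝ (s : Set E)},
      convexHull ℝ (s : Set E))ᶜ :=
    ((hM.subset fun _ h => h.1).isClosed_biUnion
      fun s _ => isClosed_convexHull_finset s).isOpen_compl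
  obtain ⟨ε, hε, hb⟩ := Metric.isOpen_iff.1 h m (by simp)
  refine ⟨ε, hε, fun s hs q hq hqs => ?_⟩
  by_contra hm
  refine hb hq ?_
  simp only [Set.mem_iUnion]
  exact ⟨s, ⟨hs, hm⟩, hqs⟩

theorem IsStarRadius.segment_subset {m : E} {ε : ℝ} (h : IsStarRadius M m ε) (hK : K ≤ M) {q : E}
    (hq : q ∈ Metric.ball m ε) (hqK : q ∈ K.space) : segment ℝ m q ⊆ K.space := by
  obtain ⟨s, hs, hqs⟩ := SimplicialComplex.mem_space_iff.1 hqK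
  exact ((convex_convexHull ℝ _).segment_subset (h s (hK hs) q hq hqs) hqs).trans
    (K.convexHull_subset_space hs)

theorem IsStarRadius.mem_space {m : E} {ε : ℝ} (h : IsStarRadius M m ε) (hK : K ≤ M) {q : E}
    (hq : q ∈ Metric.ball m ε) (hqK : q ∈ K.space) : m ∈ K.space :=
  h.segment_subset hK hq hqK (left_mem_segment ℝ m q)

end Simplices

namespace PieceDecomposition

variable {E : Type*} [NormedAddCommGroup E] [NormedSpace ℝ E] {M : SimplicialComplex ℝ E}
  {ι Γ : Type*} (D : PieceDecomposition M ι Γ) (T : Set Γ)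

/-! ### Chains of faces and the deck group -/

section Chains

open Classical in
/-- The element of `Ḡ` by which one is translated when crossing a face, trivial for the faces
in `T`. -/
def label (γ : Γ) (b : Bool) : GBar T :=
  if h : γ ∈ T then 1 else gen T ⟨γ, h⟩ b

theorem label_of_mem {γ : Γ} (h : γ ∈ T) (b : Bool) : label T γ b = 1 := dif_pos h

theorem label_of_notMem {γ : Γ} (h : γ ∉ T) (b : Bool) : label T γ b = gen T ⟨γ, h⟩ b := dif_neg h

theorem label_not (γ : Γ) (b : Bool) : label T γ (!b) = (label T γ b)⁻¹ := by
  by_cases h : γ ∈ T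
  · simp [label_of_mem T h]
  · simp [label_of_notMem T h, gen, FreeGroup.invRev]

theorem face_space_subset (γ : Γ) (b : Bool) :
    (D.face γ).space ⊆ (D.piece (D.side γ b)).space := fun _ hp => by
  obtain ⟨s, hs, hps⟩ := SimplicialComplex.mem_space_iff.1 hp
  exact SimplicialComplex.mem_space_iff.2 ⟨s, D.face_le γ b hs, hps⟩

/-- `D.Chain T p i k w`: there is a chain of faces through the point `p` leading from the piece
`i` to the piece `k`, along which one is translated by `w`. -/
inductive Chain (p : E) : ι → ι → GBar T → Prop
  | nil (i : ι) : Chain p i i 1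
  | cons (γ : Γ) (b : Bool) {k : ι} {w : GBar T} (hp : p ∈ (D.face γ).space)
      (h : Chain p (D.side γ (!b)) k w) : Chain p (D.side γ b) k (label T γ b * w)

variable {D T}

theorem Chain.single {p : E} (γ : Γ) (b : Bool) (hp : p ∈ (D.face γ).space) :
    D.Chain T p (D.side γ b) (D.side γ (!b)) (label T γ b) := by
  simpa using Chain.cons γ b hp (Chain.nil (D := D) (T := T) _)

theorem Chain.trans {p : E} {i k l : ι} {v w : GBar T} (h : D.Chain T p i k v)
    (h' : D.Chain T p k l w) : D.Chain T p i l (v * w) := by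
  induction h with
  | nil i => simpa using h'
  | cons γ b hp _ ih => rw [mul_assoc]; exact .cons γ b hp (ih h')

theorem Chain.symm {p : E} {i k : ι} {w : GBar T} (h : D.Chain T p i k w) :
    D.Chain T p k i w⁻¹ := by
  induction h with
  | nil i => simpa using Chain.nil (D := D) (T := T) i
  | cons γ b hp _ ih =>
    have h₁ := Chain.single (D := D) (T := T) γ (!b) hp
    rw [Bool.not_not, label_not] at h₁
    rw [mul_inv_rev]
    exact ih.trans h₁

/-- This transfer of chains between points is the source of both the admissibility of `deckRel` and
the local triviality of its quotient. -/
theorem Chain.mono {p q : E} (hpq : ∀ γ, p ∈ (D.face γ).space → q ∈ (D.face γ).space) {i k : ι}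
    {w : GBar T} (h : D.Chain T p i k w) : D.Chain T q i k w := by
  induction h with
  | nil i => exact .nil i
  | cons γ b hp _ ih => exact .cons γ b (hpq γ hp) ih

variable (T) in
theorem exists_chain {p : E} {i k : ι} (hi : p ∈ (D.piece i).space) (hk : p ∈ (D.piece k).space) :
    ∃ w, D.Chain T p i k w := by
  induction D.glued i k p ⟨hi, hk⟩ with
  | refl => exact ⟨1, .nil i⟩
  | tail _ h ih =>
    obtain ⟨γ, c, rfl, rfl, hp⟩ := h
    obtain ⟨w, hw⟩ := ih (D.face_space_subset γ c hp)
    exact ⟨_, hw.trans (.single γ c hp)⟩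

theorem toTotal_label (x : GBar T) (γ : Γ) (b : Bool) {p : E} (hp : p ∈ (D.face γ).space)
    (h₀ : p ∈ (D.piece (D.side γ b)).space) (h₁ : p ∈ (D.piece (D.side γ (!b))).space) :
    D.toTotal T x (D.side γ b) ⟨p, h₀⟩ =
      D.toTotal T (x * label T γ b) (D.side γ (!b)) ⟨p, h₁⟩ := by
  by_cases h : γ ∈ T
  · rw [label_of_mem T h, mul_one]
    refine congrArg (fun y => Quot.mk _ (⟨x, y⟩ : Σ _ : GBar T, D.Domain T)) ?_
    cases b
    · exact Quot.sound (.glue γ h p hp h₀ h₁)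
    · exact (Quot.sound (.glue γ h p hp h₁ h₀)).symm
  · rw [label_of_notMem T h]
    exact Quot.sound (.glue x ⟨γ, h⟩ b p hp h₀ h₁)

theorem Chain.toTotal_eq {p : E} {i k : ι} {w : GBar T} (h : D.Chain T p i k w) (x : GBar T)
    (hi : p ∈ (D.piece i).space) (hk : p ∈ (D.piece k).space) :
    D.toTotal T x i ⟨p, hi⟩ = D.toTotal T (x * w) k ⟨p, hk⟩ := by
  induction h generalizing x with
  | nil i => rw [mul_one]
  | cons γ b hp _ ih =>
    rw [toTotal_label x γ b hp hi (D.face_space_subset γ _ hp), ih, mul_assoc]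

/-- A property of the copies of the pieces which passes through all the faces passes from one copy
of a piece to all the others. -/
theorem IsArborescent.propagate (hT : D.IsArborescent T) {P : GBar T → ι → Prop}
    (step : ∀ x γ b, P x (D.side γ b) → P (x * label T γ b) (D.side γ (!b)))
    {x : GBar T} {i : ι} (h : P x i) (w : GBar T) (k : ι) : P (x * w) k := by
  -- Faces in `T` have trivial label, so walking along the tree reaches every piece of one copy of
  -- the fundamental domain.
  have tree {y : GBar T} {i : ι} (h : P y i) (k : ι) : P y k := by
    obtain ⟨u⟩ := hT.2.connected.preconnected i k
    induction u with
    | nil => exact h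
    | cons hadj _ ih =>
      refine ih ?_
      obtain ⟨⟨γ, hγ, hs⟩, -⟩ := (SimpleGraph.fromEdgeSet_adj _).1 hadj
      rcases Sym2.eq_iff.1 hs with ⟨rfl, rfl⟩ | ⟨rfl, rfl⟩
      · simpa [label_of_mem T hγ] using step y γ false h
      · simpa [label_of_mem T hγ] using step y γ true h
  have cross (γ : {γ // γ ∉ T}) (b : Bool) {y : GBar T} (h : ∀ i, P y i) (k : ι) :
      P (y * gen T γ b) k := by
    rw [← label_of_notMem T γ.2]
    exact tree (step y γ.1 b (h _)) k
  suffices ∀ {y : GBar T}, (∀ i, P y i) → ∀ i, P (y * w) i from this (tree h) k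
  induction w using FreeGroup.induction_on with
  | C1 => exact fun h => by simpa using h
  | of γ => exact cross γ true
  | inv_of γ => exact cross γ false
  | mul v w hv hw => exact fun h => by simpa only [mul_assoc] using hw (hv h)

variable (D T)

/-- The normal subgroup of `Ḡ` generated by the translations along the closed chains of faces
through the points of `M`. -/
def chainSubgroup : Subgroup (GBar T) :=
  Subgroup.normalClosure {w | ∃ i, ∃ p ∈ (D.piece i).space, D.Chain T p i i w}

instance : (D.chainSubgroup T).Normal := Subgroup.normalClosure_normal

/-- The quotient of `Ḡ` by the translations along closed chains: the deck transformation group. -/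
abbrev Deck : Type _ := GBar T ⧸ D.chainSubgroup T

open Classical in
/-- The translation from the piece `i` to the piece `k` along the faces through `p`. -/
def transition (p : E) (i k : ι) : D.Deck T :=
  if h : ∃ w, D.Chain T p i k w then (h.choose : D.Deck T) else 1

variable {D T}

theorem Chain.mk_eq_one {p : E} {i : ι} {w : GBar T} (h : D.Chain T p i i w)
    (hi : p ∈ (D.piece i).space) : (w : D.Deck T) = 1 :=
  (QuotientGroup.eq_one_iff w).2 (Subgroup.subset_normalClosure ⟨i, p, hi, h⟩)

/-- Two chains from `i` to `k` through `p` differ by a closed chain, which is trivial in the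
quotient. -/
theorem Chain.transition_eq {p : E} {i k : ι} {w : GBar T} (h : D.Chain T p i k w)
    (hi : p ∈ (D.piece i).space) : D.transition T p i k = w := by
  have h' : ∃ w, D.Chain T p i k w := ⟨w, h⟩
  rw [transition, dif_pos h']
  have := (h'.choose_spec.trans h.symm).mk_eq_one hi
  rwa [QuotientGroup.mk_mul, QuotientGroup.mk_inv, mul_inv_eq_one] at this

theorem transition_mul {p : E} {i k l : ι} (hi : p ∈ (D.piece i).space)
    (hk : p ∈ (D.piece k).space) (hl : p ∈ (D.piece l).space) :
    D.transition T p i k * D.transition T p k l = D.transition T p i l := by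
  obtain ⟨v, hv⟩ := exists_chain T hi hk
  obtain ⟨w, hw⟩ := exists_chain T hk hl
  rw [hv.transition_eq hi, hw.transition_eq hk, (hv.trans hw).transition_eq hi,
    QuotientGroup.mk_mul]

theorem transition_congr {p q : E} (hpq : ∀ γ, p ∈ (D.face γ).space → q ∈ (D.face γ).space)
    {i k : ι} (hpi : p ∈ (D.piece i).space) (hpk : p ∈ (D.piece k).space)
    (hqi : q ∈ (D.piece i).space) : D.transition T p i k = D.transition T q i k := by
  obtain ⟨w, hw⟩ := exists_chain T hpi hpk
  rw [hw.transition_eq hpi, (hw.mono hpq).transition_eq hqi]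

end Chains

/-! ### The explicit relation on `X` -/

section Sheets

theorem exists_mem_piece (p : M.space) : ∃ i, p.1 ∈ (D.piece i).space := by
  obtain ⟨s, hs, hps⟩ := SimplicialComplex.mem_space_iff.1 p.2
  obtain ⟨i, hi⟩ := D.cover s hs
  exact ⟨i, SimplicialComplex.mem_space_iff.2 ⟨s, hi, hps⟩⟩

/-- A piece containing the point `p`. -/
def pieceAt (p : M.space) : ι := (D.exists_mem_piece p).choose

theorem mem_pieceAt (p : M.space) : p.1 ∈ (D.piece (D.pieceAt p)).space :=
  (D.exists_mem_piece p).choose_spec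

/-- The translation from a point of the fundamental domain to the chosen piece at this point. -/
def domainSheet : D.Domain T → D.Deck T :=
  Quot.lift (fun q => D.transition T q.2.1 q.1
    (D.pieceAt ⟨q.2.1, D.piece_space_subset q.1 q.2.2⟩)) (by
      rintro _ _ ⟨γ, hγ, p, hf, h₀, h₁⟩
      have h : D.transition T p (D.side γ false) (D.side γ true) = 1 := by
        simpa [label_of_mem T hγ] using (Chain.single (T := T) γ false hf).transition_eq h₀
      dsimp only
      rw [← transition_mul h₀ h₁ (D.mem_pieceAt ⟨p, D.piece_space_subset _ h₀⟩), h, one_mul])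

/-- The index, in the fibre of `X/Ψ(F)` over the image of a point of `X`, of this point. -/
def sheet : D.Total T → D.Deck T :=
  Quot.lift (fun q => (q.1 : D.Deck T) * D.domainSheet T q.2) (by
    rintro _ _ ⟨x, γ, b, p, hf, h₀, h₁⟩
    dsimp only [domainSheet, toDomain]
    rw [← transition_mul h₀ h₁ (D.mem_pieceAt ⟨p, D.piece_space_subset _ h₀⟩),
      (Chain.single γ.1 b hf).transition_eq h₀, label_of_notMem T γ.2, QuotientGroup.mk_mul,
      mul_assoc])

/-- Two points of `X` over the same point of `M` are related when they have the same index in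
the fibre. -/
def deckRel : Setoid (D.Total T) := Setoid.ker fun y => (D.F T y, D.sheet T y)

variable {D T}

theorem exists_toTotal_eq (y : D.Total T) : ∃ x i p, D.toTotal T x i p = y := by
  obtain ⟨⟨x, q⟩, rfl⟩ := Quot.exists_rep y
  obtain ⟨⟨i, p⟩, rfl⟩ := Quot.exists_rep q
  exact ⟨x, i, p, rfl⟩

theorem F_toTotal (x : GBar T) (i : ι) (p : (D.piece i).space) :
    D.F T (D.toTotal T x i p) = ⟨p.1, D.piece_space_subset i p.2⟩ := rfl

theorem sheet_toTotal (x : GBar T) (i : ι) (p : (D.piece i).space) :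
    D.sheet T (D.toTotal T x i p) =
      x * D.transition T p.1 i (D.pieceAt ⟨p.1, D.piece_space_subset i p.2⟩) := rfl

/-- By the cocycle law `transition_mul`, the auxiliary piece `pieceAt` cancels from both indices. -/
theorem deckRel_toTotal_iff {x x' : GBar T} {i k : ι} {p : (D.piece i).space}
    {q : (D.piece k).space} : D.deckRel T (D.toTotal T x i p) (D.toTotal T x' k q) ↔
      p.1 = q.1 ∧ (x : D.Deck T) * D.transition T p.1 i k = x' := by
  obtain ⟨p, hp⟩ := p
  obtain ⟨q, hq⟩ := q
  rw [deckRel, Setoid.ker_def, Prod.mk.injEq, F_toTotal, F_toTotal, Subtype.mk.injEq]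
  refine and_congr_right ?_
  rintro rfl
  rw [sheet_toTotal, sheet_toTotal,
    ← transition_mul hp hq (D.mem_pieceAt ⟨p, D.piece_space_subset _ hp⟩), ← mul_assoc,
    mul_left_inj]

theorem deckRel_le_phi : D.deckRel T ≤ Phi (D.F T) := fun _ _ h => (Prod.mk.inj h).1

end Sheets

/-! ### The weak topology of `X` -/

section Topology

variable {D T}

theorem isOpen_total_iff {U : Set (D.Total T)} :
    IsOpen U ↔ ∀ x i, IsOpen (D.toTotal T x i ⁻¹' U) := by
  have h₁ : IsOpen U ↔ IsOpen ((Quot.mk (D.TotalRel T)) ⁻¹' U) := Iff.rfl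
  rw [h₁, isOpen_sigma_iff]
  refine forall_congr' fun x => ?_
  have h₂ (V : Set (D.Domain T)) : IsOpen V ↔ IsOpen ((Quot.mk (D.DomainRel T)) ⁻¹' V) := Iff.rfl
  rw [h₂, isOpen_sigma_iff]
  rfl

theorem continuous_toTotal (x : GBar T) (i : ι) : Continuous (D.toTotal T x i) :=
  continuous_def.2 fun _ hU => isOpen_total_iff.1 hU x i

theorem continuous_F : Continuous (D.F T) :=
  continuous_def.2 fun _ hU => isOpen_total_iff.2 fun x i =>
    hU.preimage (f := fun p : (D.piece i).space => (⟨p.1, D.piece_space_subset i p.2⟩ : M.space))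
      (by fun_prop)

end Topology

end PieceDecomposition

end Zipping

namespace Zipping

namespace PieceDecomposition

variable {E : Type*} [NormedAddCommGroup E] [NormedSpace ℝ E] {M : SimplicialComplex ℝ E}
  {ι Γ : Type*} {D : PieceDecomposition M ι Γ} {T : Set Γ}

/-! ### Minimality and admissibility of `deckRel` -/

section Least

variable {R : Setoid (D.Total T)}

theorem exists_nhds_injOn_of_sing_eq_empty {X Y : Type*} [TopologicalSpace X] {f : X → Y}
    (hf : Sing f = ∅) (x : X) : ∃ U ∈ 𝓝 x, Set.InjOn f U := by
  have : x ∉ Sing f := by simp [hf]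
  simpa [Sing] using this

/-- Both copies of a nearby point land in one neighbourhood in `X/R` on which the induced map is
injective, and they have the same image in `M`. -/
theorem isOpen_setOf_related (hR : R ∈ KillingRelations (D.F T) (D.cell T) (D.cellInt T))
    (x x' : GBar T) (i : ι) :
    IsOpen {q : (D.piece i).space | R (D.toTotal T x i q) (D.toTotal T x' i q)} := by
  obtain ⟨-, h, hs⟩ := hR
  rw [isOpen_iff_mem_nhds]
  intro q hq
  obtain ⟨U, hU, hinj⟩ := exists_nhds_injOn_of_sing_eq_empty hs
    (Quotient.mk R (D.toTotal T x i q))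
  have hc (z : GBar T) : Continuous fun q => Quotient.mk R (D.toTotal T z i q) :=
    continuous_quotient_mk'.comp (continuous_toTotal z i)
  have hq' : Quotient.mk R (D.toTotal T x i q) = Quotient.mk R (D.toTotal T x' i q) :=
    Quotient.sound hq
  have h₁ := (hc x).continuousAt.preimage_mem_nhds hU
  have h₂ := (hc x').continuousAt.preimage_mem_nhds (hq' ▸ hU)
  filter_upwards [h₁, h₂] with r hr₁ hr₂
  exact Quotient.exact (hinj hr₁ hr₂ rfl)

/-- Admissibility, applied to two copies of one simplex, spreads a relation at an interior point to
the closed simplex; the set is thus a finite union of closed simplices. -/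
theorem isClosed_setOf_related (hM : M.faces.Finite)
    (hR : R ∈ KillingRelations (D.F T) (D.cell T) (D.cellInt T))
    (x x' : GBar T) (i : ι) :
    IsClosed {q : (D.piece i).space | R (D.toTotal T x i q) (D.toTotal T x' i q)} := by
  set A := {q : (D.piece i).space | R (D.toTotal T x i q) (D.toTotal T x' i q)} with hA
  have key : A = ⋃ s ∈ {s ∈ (D.piece i).faces | ∃ q ∈ A, q.1 ∈ openSimplex s},
      (Subtype.val : (D.piece i).space → E) ⁻¹' convexHull ℝ (s : Set E) := by
    apply Set.Subset.antisymm
    · intro q hq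
      obtain ⟨s, hs, hqs⟩ := exists_face_mem_openSimplex q.2
      simp only [Set.mem_iUnion]
      exact ⟨s, ⟨hs, q, hq, hqs⟩, hqs.1⟩
    · simp only [Set.iUnion_subset_iff]
      rintro s ⟨hs, q, hq, hqs⟩ r hr
      have himage (z : GBar T) : D.F T '' D.cell T (z, ⟨i, s, hs⟩) =
          {p | p.1 ∈ convexHull ℝ (s : Set E)} := by
        ext p
        constructor
        · rintro ⟨_, ⟨p, hp, rfl⟩, rfl⟩
          exact hp
        · intro hp
          exact ⟨_, ⟨⟨p, (D.piece i).convexHull_subset_space hs hp⟩, hp, rfl⟩, rfl⟩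
      exact hR.1 (x, ⟨i, s, hs⟩) (x', ⟨i, s, hs⟩) ((himage x).trans (himage x').symm)
        ⟨_, ⟨q, hqs, rfl⟩, _, ⟨q, hqs, rfl⟩, rfl, hq⟩ _ ⟨r, hr, rfl⟩ _ ⟨r, hr, rfl⟩ rfl
  rw [key]
  exact ((hM.subset (D.piece_le i)).subset fun _ h => h.1).isClosed_biUnion fun s _ =>
    (isClosed_convexHull_finset s).preimage continuous_subtype_val

theorem related_of_related (hM : M.faces.Finite)
    (hR : R ∈ KillingRelations (D.F T) (D.cell T) (D.cellInt T))
    {x x' : GBar T} {i : ι} {q : (D.piece i).space}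
    (h : R (D.toTotal T x i q) (D.toTotal T x' i q)) (r : (D.piece i).space) :
    R (D.toTotal T x i r) (D.toTotal T x' i r) := by
  have := D.piece_simplyConnected i
  have huniv := IsClopen.eq_univ
    ⟨isClosed_setOf_related hM hR x x' i, isOpen_setOf_related hR x x' i⟩ ⟨q, h⟩
  exact Set.eq_univ_iff_forall.1 huniv r

/-- A face is nonempty, and each of its points belongs to the copies on both sides, so an
identification of copies crosses it. -/
theorem related_mul_right (hT : D.IsArborescent T) (hM : M.faces.Finite)
    (hR : R ∈ KillingRelations (D.F T) (D.cell T) (D.cellInt T)) {x x' : GBar T} {i : ι}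
    {q : (D.piece i).space} (h : R (D.toTotal T x i q) (D.toTotal T x' i q)) (w : GBar T) (k : ι)
    (r : (D.piece k).space) : R (D.toTotal T (x * w) k r) (D.toTotal T (x' * w) k r) := by
  rw [← one_mul w]
  refine hT.propagate
    (P := fun v k => ∀ r, R (D.toTotal T (x * v) k r) (D.toTotal T (x' * v) k r))
    (fun v γ b hv => ?_) (i := i) ?_ w k r
  · obtain ⟨p, hp⟩ := (D.face_connected γ).nonempty
    refine related_of_related hM hR (q := ⟨p, D.face_space_subset γ _ hp⟩) ?_
    rw [← mul_assoc, ← mul_assoc, ← toTotal_label (x * v) γ b hp (D.face_space_subset γ b hp),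
      ← toTotal_label (x' * v) γ b hp (D.face_space_subset γ b hp)]
    exact hv _
  · simpa using related_of_related hM hR h

variable (R) in
/-- `R` identifies the copies of index `x` and `x'` of the fundamental domain. -/
def CopiesRelated (x x' : GBar T) : Prop :=
  ∀ i q, R (D.toTotal T x i q) (D.toTotal T x' i q)

variable (R) in
/-- The translations which move every copy of the fundamental domain to one with which `R`
identifies it. -/
def trivialTranslations : Subgroup (GBar T) where
  carrier := {w | ∀ x, CopiesRelated R x (x * w)}
  one_mem' x i q := by simp
  mul_mem' {v w} hv hw x i q := by
    rw [← mul_assoc]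
    exact R.trans (hv x i q) (hw (x * v) i q)
  inv_mem' {w} hw x i q := by
    have := hw (x * w⁻¹) i q
    rw [inv_mul_cancel_right] at this
    exact R.symm this

theorem chainSubgroup_le_trivialTranslations (hT : D.IsArborescent T) (hM : M.faces.Finite)
    (hR : R ∈ KillingRelations (D.F T) (D.cell T) (D.cellInt T)) :
    D.chainSubgroup T ≤ trivialTranslations R := by
  -- For `v * w * v⁻¹`, use the triviality of `w` at `x * v`, then translate on the right by `v⁻¹`.
  have : (trivialTranslations R).Normal := by
    refine ⟨fun w hw v x i q => ?_⟩
    simpa [mul_assoc] using related_mul_right hT hM hR (hw (x * v) i q) v⁻¹ i q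
  refine Subgroup.normalClosure_le_normal ?_
  rintro w ⟨i, p, hp, hw⟩ x k q
  have h : R (D.toTotal T x i ⟨p, hp⟩) (D.toTotal T (x * w) i ⟨p, hp⟩) := by
    rw [hw.toTotal_eq x hp hp]
  simpa using related_mul_right hT hM hR h 1 k q

theorem deckRel_le (hT : D.IsArborescent T) (hM : M.faces.Finite)
    (hR : R ∈ KillingRelations (D.F T) (D.cell T) (D.cellInt T)) : D.deckRel T ≤ R := by
  intro y y' h
  obtain ⟨x, i, ⟨p, hi⟩, rfl⟩ := exists_toTotal_eq y
  obtain ⟨x', k, ⟨p', hk⟩, rfl⟩ := exists_toTotal_eq y'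
  obtain ⟨hpp, hx⟩ := deckRel_toTotal_iff.1 h
  dsimp only at hpp hx
  subst hpp
  obtain ⟨w, hw⟩ := exists_chain T hi hk
  rw [hw.transition_eq hi, ← QuotientGroup.mk_mul, QuotientGroup.eq] at hx
  rw [hw.toTotal_eq x hi hk]
  have := chainSubgroup_le_trivialTranslations hT hM hR hx (x * w) k ⟨p, hk⟩
  rwa [mul_inv_cancel_left] at this

/-- A face of the decomposition containing an interior point of a simplex contains the whole
simplex, so transitions at that point are also transitions at every other point of it. -/
theorem admissible_deckRel : Admissible (D.F T) (D.cell T) (D.cellInt T) (D.deckRel T) := by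
  rintro ⟨x, i, s, hs⟩ ⟨x', k, t, ht⟩ - ⟨_, ⟨p, hp, rfl⟩, _, ⟨p', -, rfl⟩, -, h⟩
    _ ⟨q, hq, rfl⟩ _ ⟨q', -, rfl⟩ hqq'
  obtain ⟨hpp', h⟩ := deckRel_toTotal_iff.1 h
  refine deckRel_toTotal_iff.2 ⟨congrArg Subtype.val hqq', ?_⟩
  rw [← h, transition_congr (q := q.1) (fun γ hγ => ?_) p.2 (hpp' ▸ p'.2) q.2]
  exact convexHull_subset_space_of_mem_openSimplex (D.piece_le i hs)
    (fun u hu => D.piece_le _ (D.face_le γ true hu)) hp hγ hq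

end Least

end PieceDecomposition

end Zipping

namespace Zipping

namespace PieceDecomposition

variable {E : Type*} [NormedAddCommGroup E] [NormedSpace ℝ E] {M : SimplicialComplex ℝ E}
  {ι Γ : Type*} {D : PieceDecomposition M ι Γ} {T : Set Γ}

/-! ### The quotient is a covering of `M` -/

section Covering

variable (D T)

/-- The quotient of `X` by `deckRel`. -/
abbrev DeckSpace : Type _ := Quotient (D.deckRel T)

/-- The projection of `DeckSpace` to `M`. -/
abbrev deckProj : D.DeckSpace T → M.space := descend (D.F T) (D.deckRel T) deckRel_le_phi

/-- The index of a point of `DeckSpace` in its fibre. -/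
def deckSheet : D.DeckSpace T → D.Deck T :=
  Quotient.lift (D.sheet T) fun _ _ h => (Prod.mk.inj h).2

/-- The point of `DeckSpace` given by a point of a piece of the copy of index `x`. -/
def toDeckSpace (x : GBar T) (i : ι) (p : (D.piece i).space) : D.DeckSpace T :=
  Quotient.mk _ (D.toTotal T x i p)

/-- The coordinate along the fibres of the trivialization of `deckProj` around `m`. -/
def fiberCoord (m : M.space) (y : D.DeckSpace T) : D.Deck T :=
  D.deckSheet T y * D.transition T m.1 (D.pieceAt (D.deckProj T y)) (D.pieceAt m)

variable {D T}

theorem exists_toDeckSpace_eq (y : D.DeckSpace T) : ∃ x i p, D.toDeckSpace T x i p = y := by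
  obtain ⟨z, rfl⟩ := Quotient.exists_rep y
  obtain ⟨x, i, p, rfl⟩ := exists_toTotal_eq z
  exact ⟨x, i, p, rfl⟩

theorem deckProj_toDeckSpace (x : GBar T) (i : ι) (p : (D.piece i).space) :
    D.deckProj T (D.toDeckSpace T x i p) = ⟨p.1, D.piece_space_subset i p.2⟩ := rfl

theorem deckSheet_toDeckSpace (x : GBar T) (i : ι) (p : (D.piece i).space) :
    D.deckSheet T (D.toDeckSpace T x i p) =
      x * D.transition T p.1 i (D.pieceAt ⟨p.1, D.piece_space_subset i p.2⟩) := rfl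

theorem continuous_toDeckSpace (x : GBar T) (i : ι) : Continuous (D.toDeckSpace T x i) :=
  continuous_quotient_mk'.comp (continuous_toTotal x i)

theorem isOpen_deckSpace_iff {U : Set (D.DeckSpace T)} :
    IsOpen U ↔ ∀ x i, IsOpen (D.toDeckSpace T x i ⁻¹' U) := by
  rw [← isQuotientMap_quotient_mk'.isOpen_preimage, isOpen_total_iff]
  rfl

theorem continuous_deckProj : Continuous (D.deckProj T) := continuous_F.quotient_lift _

theorem surjective_deckProj : Function.Surjective (D.deckProj T) := fun p =>
  ⟨D.toDeckSpace T 1 (D.pieceAt p) ⟨p, D.mem_pieceAt p⟩, rfl⟩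

theorem deckSpace_ext {y y' : D.DeckSpace T} (h : D.deckProj T y = D.deckProj T y')
    (h' : D.deckSheet T y = D.deckSheet T y') : y = y' := by
  induction y using Quotient.inductionOn
  induction y' using Quotient.inductionOn
  exact Quotient.sound (Prod.ext h h')

theorem deckSpace_ext_fiberCoord (m : M.space) {y y' : D.DeckSpace T}
    (h : D.deckProj T y = D.deckProj T y') (h' : D.fiberCoord T m y = D.fiberCoord T m y') :
    y = y' := by
  refine deckSpace_ext h ?_
  rwa [fiberCoord, fiberCoord, h, mul_left_inj] at h'

theorem mem_piece_of_mem_ball {m : M.space} {ε : ℝ} (hε : IsStarRadius M m.1 ε) {q : E}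
    (hq : q ∈ Metric.ball m.1 ε) {i : ι} (hi : q ∈ (D.piece i).space) :
    m.1 ∈ (D.piece i).space :=
  hε.mem_space (D.piece_le i) hq hi

/-- A face through a point of the ball also passes through `m`, so the transition at that point can
be computed at `m`: the coordinate is constant on each copy of a piece over the ball. -/
theorem fiberCoord_toDeckSpace {m : M.space} {ε : ℝ} (hε : IsStarRadius M m.1 ε) (x : GBar T)
    (i : ι) (p : (D.piece i).space) (hp : p.1 ∈ Metric.ball m.1 ε) :
    D.fiberCoord T m (D.toDeckSpace T x i p) =
      x * D.transition T m.1 i (D.pieceAt m) := by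
  set p' : M.space := ⟨p.1, D.piece_space_subset i p.2⟩ with hp'
  have h₁ : p.1 ∈ (D.piece (D.pieceAt p')).space := D.mem_pieceAt p'
  rw [fiberCoord, deckSheet_toDeckSpace, deckProj_toDeckSpace, ← hp', mul_assoc,
    transition_congr (q := m.1) (fun γ hγ => ?_) p.2 h₁ (mem_piece_of_mem_ball hε hp p.2),
    transition_mul (mem_piece_of_mem_ball hε hp p.2) (mem_piece_of_mem_ball hε hp h₁)
      (D.mem_pieceAt m)]
  exact hε.mem_space (fun u hu => D.piece_le _ (D.face_le γ true hu)) hp hγ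

theorem isOpen_setOf_fiberCoord {m : M.space} {ε : ℝ} (hε : IsStarRadius M m.1 ε)
    (S : Set (D.Deck T)) :
    IsOpen {y : D.DeckSpace T | (D.deckProj T y).1 ∈ Metric.ball m.1 ε ∧
      D.fiberCoord T m y ∈ S} := by
  refine isOpen_deckSpace_iff.2 fun x i => ?_
  have h : IsOpen {p : (D.piece i).space | p.1 ∈ Metric.ball m.1 ε ∧
      (x : D.Deck T) * D.transition T m.1 i (D.pieceAt m) ∈ S} :=
    (Metric.isOpen_ball.preimage continuous_subtype_val).and isOpen_const
  convert h using 1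
  ext p
  exact and_congr_right fun hp => by rw [fiberCoord_toDeckSpace hε x i p hp]

theorem mk_out (c : D.Deck T) : ((c.out : GBar T) : D.Deck T) = c := Quotient.out_eq c

variable (T) in
/-- The point of `DeckSpace` over `q` with coordinate `c` along the fibres of the trivialization
around `m`. -/
def deckSection (m : M.space) (c : D.Deck T) (q : M.space) : D.DeckSpace T :=
  D.toDeckSpace T (c * (D.transition T m.1 (D.pieceAt q) (D.pieceAt m))⁻¹).out (D.pieceAt q)
    ⟨q, D.mem_pieceAt q⟩

theorem fiberCoord_deckSection {m : M.space} {ε : ℝ} (hε : IsStarRadius M m.1 ε) (c : D.Deck T)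
    {q : M.space} (hq : q.1 ∈ Metric.ball m.1 ε) :
    D.fiberCoord T m (deckSection T m c q) = c := by
  rw [deckSection, fiberCoord_toDeckSpace hε _ _ ⟨q, D.mem_pieceAt q⟩ hq, mk_out,
    inv_mul_cancel_right]

/-- The pieces are finitely many closed sets covering the ball; over each of them the section stays
in a single copy of that piece. -/
theorem continuous_deckSection [Finite ι] (hM : M.faces.Finite) {m : M.space} {ε : ℝ}
    (hε : IsStarRadius M m.1 ε) (c : D.Deck T) :
    Continuous fun q : {q : M.space | q.1 ∈ Metric.ball m.1 ε} => deckSection T m c q.1 := by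
  refine (locallyFinite_of_finite fun i : ι =>
    {q : {q : M.space | q.1 ∈ Metric.ball m.1 ε} | q.1.1 ∈ (D.piece i).space}).continuous ?_ ?_ ?_
  · exact Set.eq_univ_of_forall fun q => Set.mem_iUnion.2 (D.exists_mem_piece q.1)
  · exact fun i => (isClosed_space (hM.subset (D.piece_le i))).preimage (by fun_prop)
  · intro i
    rw [continuousOn_iff_continuous_domRestrict]
    have h : Continuous fun q : {q : {q : M.space | q.1 ∈ Metric.ball m.1 ε} |
        q.1.1 ∈ (D.piece i).space} =>
        D.toDeckSpace T (c * (D.transition T m.1 i (D.pieceAt m))⁻¹).out i ⟨q.1.1.1, q.2⟩ :=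
      (continuous_toDeckSpace _ i).comp (by fun_prop)
    refine h.congr fun q => deckSpace_ext_fiberCoord m rfl ?_
    rw [fiberCoord_toDeckSpace hε _ _ ⟨q.1.1.1, q.2⟩ q.1.2, mk_out, inv_mul_cancel_right]
    exact (fiberCoord_deckSection hε c q.1.2).symm

theorem isCoveringMap_deckProj [Finite ι] (hM : M.faces.Finite) : IsCoveringMap (D.deckProj T) := by
  intro m
  obtain ⟨ε, hε₀, hε⟩ := exists_isStarRadius hM m.1
  let : TopologicalSpace (D.Deck T) := ⊥
  have : DiscreteTopology (D.Deck T) := ⟨rfl⟩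
  have hU : IsOpen {q : M.space | q.1 ∈ Metric.ball m.1 ε} :=
    Metric.isOpen_ball.preimage continuous_subtype_val
  refine IsEvenlyCovered.to_isEvenlyCovered_preimage (I := D.Deck T)
    ⟨inferInstance, {q | q.1 ∈ Metric.ball m.1 ε}, Metric.mem_ball_self hε₀, hU,
      hU.preimage continuous_deckProj, ?_⟩
  refine ⟨{
    toFun y := (⟨D.deckProj T y.1, y.2⟩, D.fiberCoord T m y.1)
    invFun z := ⟨deckSection T m z.2 z.1.1, z.1.2⟩
    left_inv y := Subtype.ext <| deckSpace_ext_fiberCoord m rfl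
      (fiberCoord_deckSection hε _ y.2)
    right_inv z := Prod.ext rfl (fiberCoord_deckSection hε _ z.1.2)
    continuous_toFun := ?_
    continuous_invFun := ?_ }, fun _ => rfl⟩
  · refine Continuous.prodMk ((continuous_deckProj.comp continuous_subtype_val).subtype_mk _) ?_
    refine continuous_def.2 fun S _ => ?_
    convert (isOpen_setOf_fiberCoord hε S).preimage
      (continuous_subtype_val (p := fun y => y ∈ D.deckProj T ⁻¹' {q | q.1 ∈ Metric.ball m.1 ε}))
      using 1
    ext y
    exact ⟨fun h => ⟨y.2, h⟩, fun h => h.2⟩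
  · exact (continuous_prod_of_discrete_right.2 fun c =>
      continuous_deckSection hM hε c).subtype_mk _

theorem deckRel_mem_killingRelations [Finite ι] (hM : M.faces.Finite) :
    D.deckRel T ∈ KillingRelations (D.F T) (D.cell T) (D.cellInt T) := by
  refine ⟨admissible_deckRel, deckRel_le_phi, Set.eq_empty_iff_forall_notMem.2 fun y hy => ?_⟩
  obtain ⟨U, hU, hinj⟩ :=
    ((isCoveringMap_deckProj (D := D) (T := T) hM).isLocalHomeomorph).isLocallyInjective y
  exact hy U (hU.mem_nhds hinj.1) hinj.2

end Covering

end PieceDecomposition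

end Zipping

namespace Zipping

open CategoryTheory

/-! ### Homotopies of paths and potentials on trees -/

section Groupoid

theorem homotopic_of_forall_mem {Z : Type*} [TopologicalSpace Z] {A : Set Z}
    (hA : IsSimplyConnected A) {a b : Z} (p q : Path a b) (hp : ∀ t, p t ∈ A)
    (hq : ∀ t, q t ∈ A) : p.Homotopic q := by
  have := hA.simplyConnectedSpace
  have ha : a ∈ A := by simpa using hp 0
  have hb : b ∈ A := by simpa using hp 1
  let lift (r : Path a b) (hr : ∀ t, r t ∈ A) : Path (⟨a, ha⟩ : A) ⟨b, hb⟩ :=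
    { toFun := fun t => ⟨r t, hr t⟩
      source' := by simp
      target' := by simp }
  exact (SimplyConnectedSpace.paths_homotopic (lift p hp) (lift q hq)).map
    ⟨Subtype.val, continuous_subtype_val⟩

variable {C : Type*} [Category C] {V : Type*} {G : SimpleGraph V} {X : V → C}

/-- The composition of morphisms along a walk. -/
def walkHom (f : ∀ u v, G.Adj u v → (X u ⟶ X v)) : ∀ {u v : V}, G.Walk u v → (X u ⟶ X v)
  | _, _, .nil => 𝟙 _
  | _, _, .cons h w => f _ _ h ≫ walkHom f w

theorem walkHom_append (f : ∀ u v, G.Adj u v → (X u ⟶ X v)) {u v w : V} (p : G.Walk u v)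
    (q : G.Walk v w) : walkHom f (p.append q) = walkHom f p ≫ walkHom f q := by
  induction p with
  | nil => simp [walkHom]
  | cons h p ih => simp [walkHom, ih]

/-- Isomorphisms along the edges of a tree are the coboundary of isomorphisms to a root. -/
theorem exists_potential (hG : G.IsTree) (f : ∀ u v, G.Adj u v → (X u ⟶ X v))
    (hf : ∀ u v h, f u v h ≫ f v u h.symm = 𝟙 _) (r : V) :
    ∃ t : ∀ v, X v ⟶ X r, ∀ u v h, f u v h ≫ t v = t u := by
  classical
  choose P hP using fun v => (hG.existsUnique_path v r).exists
  have huniq {u v : V} {p q : G.Walk u v} (hp : p.IsPath) (hq : q.IsPath) : p = q :=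
    (hG.existsUnique_path u v).unique hp hq
  refine ⟨fun v => walkHom f (P v), fun u v h => ?_⟩
  dsimp only
  -- By uniqueness of paths in a tree, either the path from `v` to `r` starts with the edge to `u`,
  -- or the path from `u` to `r` starts with the edge to `v`.
  by_cases hu : u ∈ (P v).support
  · have h₁ : (P v).takeUntil u hu = .cons h.symm .nil :=
      huniq ((hP v).takeUntil hu) (by simp [h.ne'])
    have h₂ : (P v).dropUntil u hu = P u := huniq ((hP v).dropUntil hu) (hP u)
    rw [← (P v).take_spec hu, walkHom_append, h₁, h₂]
    simp [walkHom, reassoc_of% hf u v h]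
  · rw [huniq (hP u) ((hP v).cons (h := h) hu)]
    rfl

end Groupoid

namespace PieceDecomposition

variable {E : Type*} [NormedAddCommGroup E] [NormedSpace ℝ E] {M : SimplicialComplex ℝ E}
  {ι Γ : Type*} {D : PieceDecomposition M ι Γ} {T : Set Γ}

/-! ### Paths inside the pieces -/

section PieceHom

variable (D) in
/-- The inclusion of a piece. -/
def incl (i : ι) : C((D.piece i).space, M.space) where
  toFun p := ⟨p.1, D.piece_space_subset i p.2⟩

instance (i : ι) : SimplyConnectedSpace (D.piece i).space := D.piece_simplyConnected i

/-- The class of the paths from `p` to `q` in the piece `i`. -/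
def pieceHom {i : ι} {p q : M.space} (hp : p.1 ∈ (D.piece i).space)
    (hq : q.1 ∈ (D.piece i).space) : FundamentalGroupoid.mk p ⟶ FundamentalGroupoid.mk q :=
  Path.Homotopic.Quotient.mk
    ((PathConnectedSpace.somePath (⟨p.1, hp⟩ : (D.piece i).space) ⟨q.1, hq⟩).map
      (D.incl i).continuous)

theorem mk_map_incl {i : ι} {p q : (D.piece i).space} (γ : Path p q) :
    Path.Homotopic.Quotient.mk (γ.map (D.incl i).continuous) =
      pieceHom (p := D.incl i p) (q := D.incl i q) p.2 q.2 :=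
  Path.Homotopic.Quotient.eq.2 ((SimplyConnectedSpace.paths_homotopic γ _).map (D.incl i))

theorem pieceHom_comp {i : ι} {p q r : M.space} (hp : p.1 ∈ (D.piece i).space)
    (hq : q.1 ∈ (D.piece i).space) (hr : r.1 ∈ (D.piece i).space) :
    pieceHom hp hq ≫ pieceHom hq hr = pieceHom hp hr := by
  have := mk_map_incl ((PathConnectedSpace.somePath (⟨p.1, hp⟩ : (D.piece i).space)
    ⟨q.1, hq⟩).trans (PathConnectedSpace.somePath (⟨q.1, hq⟩ : (D.piece i).space) ⟨r.1, hr⟩))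
  rw [Path.map_trans, Path.Homotopic.Quotient.mk_trans] at this
  exact this

theorem pieceHom_self {i : ι} {p : M.space} (hp : p.1 ∈ (D.piece i).space) :
    pieceHom hp hp = 𝟙 _ :=
  (mk_map_incl (Path.refl (⟨p.1, hp⟩ : (D.piece i).space))).symm

/-- A path inside the face lies in both adjacent pieces and represents both classes. -/
theorem pieceHom_eq_of_face {γ : Γ} {p q : M.space} (hp : p.1 ∈ (D.face γ).space)
    (hq : q.1 ∈ (D.face γ).space) (b c : Bool) :
    pieceHom (D.face_space_subset γ b hp) (D.face_space_subset γ b hq) =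
      pieceHom (D.face_space_subset γ c hp) (D.face_space_subset γ c hq) := by
  have := isPathConnected_iff_pathConnectedSpace.1 (D.face_connected γ)
  have h (b : Bool) : Continuous (Set.inclusion (D.face_space_subset γ b)) :=
    continuous_inclusion _
  have δ : Path (⟨p.1, hp⟩ : (D.face γ).space) ⟨q.1, hq⟩ := PathConnectedSpace.somePath _ _
  exact (mk_map_incl (δ.map (h b))).symm.trans (mk_map_incl (δ.map (h c)))

theorem isSimplyConnected_star (m : M.space) {ε : ℝ} (hε₀ : 0 < ε) (hε : IsStarRadius M m.1 ε) :
    IsSimplyConnected {q : M.space | q.1 ∈ Metric.ball m.1 ε} := by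
  rw [← Topology.IsEmbedding.subtypeVal.isSimplyConnected_image]
  have h : Subtype.val '' {q : M.space | q.1 ∈ Metric.ball m.1 ε} =
      Metric.ball m.1 ε ∩ M.space := by
    ext q
    simp [and_comm]
  have hm : m.1 ∈ Metric.ball m.1 ε := Metric.mem_ball_self hε₀
  rw [h]
  have hstar : StarConvex ℝ m.1 (Metric.ball m.1 ε ∩ M.space) :=
    starConvex_iff_segment_subset.2 fun q hq => Set.subset_inter
      ((convex_ball _ _).segment_subset hm hq.1) (hε.segment_subset le_rfl hq.1 hq.2)
  have := hstar.contractibleSpace ⟨m.1, hm, m.2⟩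
  exact SimplyConnectedSpace.ofContractible _

/-- In the star of `p`, all paths are homotopic to a path in a piece. -/
theorem mk_eq_pieceHom {i : ι} {p q : M.space} (hp : p.1 ∈ (D.piece i).space)
    (hq : q.1 ∈ (D.piece i).space) {ε : ℝ} (hε₀ : 0 < ε)
    (hε : IsStarRadius M p.1 ε) (δ : Path p q)
    (hδ : ∀ t, (δ t).1 ∈ Metric.ball p.1 ε) : Path.Homotopic.Quotient.mk δ = pieceHom hp hq := by
  have hqb : q.1 ∈ Metric.ball p.1 ε := by simpa using hδ 1
  have hseg := hε.segment_subset (D.piece_le i) hqb hq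
  have hjoin : JoinedIn (segment ℝ p.1 q.1) p.1 q.1 :=
    ((convex_segment p.1 q.1).isPathConnected ⟨p.1, left_mem_segment ℝ _ _⟩).joinedIn _
      (left_mem_segment ℝ _ _) _ (right_mem_segment ℝ _ _)
  let s : Path (⟨p.1, hp⟩ : (D.piece i).space) ⟨q.1, hq⟩ :=
    { toFun := fun t => ⟨hjoin.somePath t, hseg (hjoin.somePath_mem t)⟩
      source' := by simp
      target' := by simp }
  refine (Path.Homotopic.Quotient.eq.2 ?_).trans (mk_map_incl s)
  refine homotopic_of_forall_mem (isSimplyConnected_star p hε₀ hε) _ _ hδ fun t => ?_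
  exact (convex_ball _ _).segment_subset (Metric.mem_ball_self hε₀) hqb (hjoin.somePath_mem t)

end PieceHom

/-! ### Crossing the faces of the spanning tree -/

section Root

variable (D) in
/-- A base point of a piece. -/
def basePoint (i : ι) : M.space := D.incl i (Classical.arbitrary _)

theorem basePoint_mem (i : ι) : (D.basePoint i).1 ∈ (D.piece i).space :=
  (Classical.arbitrary (D.piece i).space).2

variable (D) in
/-- The base point of a piece as an object of the fundamental groupoid of `M`. -/
abbrev baseObj (i : ι) : FundamentalGroupoid M.space := .mk (D.basePoint i)

/-- The class of the paths between base points which pass from a piece to another at `p`. -/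
def crossHom {p : M.space} {i k : ι} (hi : p.1 ∈ (D.piece i).space)
    (hk : p.1 ∈ (D.piece k).space) : D.baseObj i ⟶ D.baseObj k :=
  pieceHom (basePoint_mem i) hi ≫ pieceHom hk (basePoint_mem k)

theorem pieceHom_comp_crossHom {p : M.space} {i k : ι} (hi : p.1 ∈ (D.piece i).space)
    (hk : p.1 ∈ (D.piece k).space) :
    pieceHom hi (basePoint_mem i) ≫ crossHom hi hk = pieceHom hk (basePoint_mem k) := by
  rw [crossHom, reassoc_of% pieceHom_comp hi (basePoint_mem i) hi, pieceHom_self, Category.id_comp]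

theorem crossHom_comp_crossHom {p : M.space} {i k : ι} (hi : p.1 ∈ (D.piece i).space)
    (hk : p.1 ∈ (D.piece k).space) : crossHom hi hk ≫ crossHom hk hi = 𝟙 _ := by
  rw [crossHom, Category.assoc, pieceHom_comp_crossHom, pieceHom_comp, pieceHom_self]

theorem crossHom_eq_of_face {γ : Γ} {p q : M.space} (hp : p.1 ∈ (D.face γ).space)
    (hq : q.1 ∈ (D.face γ).space) (b c : Bool) :
    crossHom (D.face_space_subset γ b hp) (D.face_space_subset γ c hp) =
      crossHom (D.face_space_subset γ b hq) (D.face_space_subset γ c hq) := by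
  rw [crossHom, crossHom,
    ← pieceHom_comp (basePoint_mem _) (D.face_space_subset γ b hq) (D.face_space_subset γ b hp),
    pieceHom_eq_of_face hq hp b c, Category.assoc, pieceHom_comp]

theorem face_space_subset_space (γ : Γ) : (D.face γ).space ⊆ M.space :=
  (D.face_space_subset γ true).trans (D.piece_space_subset _)

theorem exists_treeHom (hT : D.IsArborescent T) : ∃ r, ∃ t : ∀ i, D.baseObj i ⟶ D.baseObj r,
    ∀ γ ∈ T, ∀ b, ∀ p : M.space, ∀ hp : p.1 ∈ (D.face γ).space,
      crossHom (D.face_space_subset γ b hp) (D.face_space_subset γ (!b) hp) ≫ t _ = t _ := by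
  obtain ⟨r⟩ := hT.2.connected.nonempty
  choose γ hγT hγ using fun i k h => ((SimpleGraph.fromEdgeSet_adj _).1 h :
    s(i, k) ∈ (fun γ => s(D.side γ false, D.side γ true)) '' T ∧ i ≠ k).1
  choose p hp using fun γ => (D.face_connected γ).nonempty
  have hmem i k h : p (γ i k h) ∈ (D.piece i).space := by
    rcases Sym2.eq_iff.1 (hγ i k h) with ⟨h₁, -⟩ | ⟨-, h₁⟩
    · have := D.face_space_subset _ false (hp (γ i k h)); rwa [h₁] at this
    · have := D.face_space_subset _ true (hp (γ i k h)); rwa [h₁] at this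
  -- Distinct faces in `T` give distinct edges, so both orientations of an edge select the same
  -- face.
  have hsymm i k h : γ k i (h : (SimpleGraph.fromEdgeSet _).Adj i k).symm = γ i k h :=
    hT.1 (hγT _ _ _) (hγT _ _ _) ((hγ _ _ _).trans (Sym2.eq_swap.trans (hγ _ _ _).symm))
  have hmem' i k h : p (γ i k h) ∈ (D.piece k).space := hsymm i k h ▸ hmem k i h.symm
  obtain ⟨t, ht⟩ := exists_potential (X := D.baseObj) hT.2
    (fun i k h => crossHom (p := ⟨_, D.face_space_subset_space _ (hp (γ i k h))⟩)
      (hmem i k h) (hmem' i k h))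
    (fun i k h => by simp only [hsymm i k h]; exact crossHom_comp_crossHom _ _) r
  refine ⟨r, t, fun δ hδ b q hq => ?_⟩
  have hadj : (SimpleGraph.fromEdgeSet
      ((fun γ => s(D.side γ false, D.side γ true)) '' T)).Adj (D.side δ b) (D.side δ (!b)) := by
    refine (SimpleGraph.fromEdgeSet_adj _).2 ⟨⟨δ, hδ, ?_⟩, ?_⟩
    · cases b
      · rfl
      · exact Sym2.eq_swap
    · cases b
      · exact D.side_ne δ
      · exact (D.side_ne δ).symm
  have hδγ : γ _ _ hadj = δ := by
    refine hT.1 (hγT _ _ _) hδ ((hγ _ _ _).trans ?_)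
    cases b
    · rfl
    · exact Sym2.eq_swap
  rw [← ht _ _ hadj]
  congr 1
  have hq' : p (γ _ _ hadj) ∈ (D.face δ).space := by
    have := hp (γ _ _ hadj)
    rwa [hδγ] at this ⊢
  exact crossHom_eq_of_face (q := ⟨_, D.face_space_subset_space _ hq'⟩) hq hq' b (!b)

end Root

end PieceDecomposition

end Zipping

namespace Zipping

open CategoryTheory

namespace PieceDecomposition

variable {E : Type*} [NormedAddCommGroup E] [NormedSpace ℝ E] {M : SimplicialComplex ℝ E}
  {ι Γ : Type*} {D : PieceDecomposition M ι Γ} {T : Set Γ}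

/-! ### Monodromy and simple connectivity -/

section Monodromy

theorem exists_translationHom (hT : D.IsArborescent T) :
    ∃ r, ∃ t : ∀ i, D.baseObj i ⟶ D.baseObj r, ∃ φ : GBar T →* End (D.baseObj r),
      ∀ γ b, ∀ p : M.space, ∀ hp : p.1 ∈ (D.face γ).space,
        crossHom (D.face_space_subset γ b hp) (D.face_space_subset γ (!b) hp) ≫ t _ ≫
          End.asHom (φ (label T γ b)) = t _ := by
  obtain ⟨r, t, ht⟩ := exists_treeHom hT
  choose p hp using fun γ => (D.face_connected γ).nonempty
  let c (γ : Γ) (b : Bool) : D.baseObj (D.side γ b) ⟶ D.baseObj (D.side γ (!b)) :=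
    crossHom (p := ⟨p γ, D.face_space_subset_space γ (hp γ)⟩) (D.face_space_subset γ b (hp γ))
      (D.face_space_subset γ (!b) (hp γ))
  -- This value on generators is forced by the required identity for `b = true`; the case `b =
  -- false` follows by inversion.
  let φ : GBar T →* End (D.baseObj r) := FreeGroup.lift fun γ =>
    End.of (Groupoid.inv (t (D.side γ false)) ≫ c γ false ≫ t (D.side γ true))
  refine ⟨r, t, φ, fun γ b q hq => ?_⟩
  rw [crossHom_eq_of_face (q := ⟨p γ, D.face_space_subset_space γ (hp γ)⟩) hq (hp γ)]
  change c γ b ≫ _ = _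
  by_cases hγ : γ ∈ T
  · rw [label_of_mem T hγ, map_one]
    exact (congrArg _ (Category.comp_id _)).trans (ht γ hγ b _ (hp γ))
  have hφ : φ (label T γ true) =
      Groupoid.inv (t (D.side γ false)) ≫ c γ false ≫ t (D.side γ true) := by
    rw [label_of_notMem T hγ]
    exact FreeGroup.lift_apply_of
  have hcc : c γ true ≫ c γ false = 𝟙 _ := crossHom_comp_crossHom _ _
  have htrue : c γ true ≫ t _ ≫ End.asHom (φ (label T γ true)) = t _ := by
    have ht : t (D.side γ false) ≫ Groupoid.inv (t (D.side γ false)) = 𝟙 _ := Groupoid.comp_inv _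
    rw [hφ]
    change c γ true ≫ t (D.side γ false) ≫ _ = _
    rw [reassoc_of% ht, reassoc_of% hcc]
  cases b
  · have hinv : End.asHom (φ (label T γ true)) ≫ End.asHom (φ (label T γ false)) = 𝟙 _ := by
      rw [← End.mul_def, ← map_mul, show label T γ false = (label T γ true)⁻¹ from label_not T γ true,
        inv_mul_cancel, map_one]
      rfl
    have hcc' : c γ false ≫ c γ true = 𝟙 _ := crossHom_comp_crossHom _ _
    change c γ false ≫ t (D.side γ true) ≫ _ = _
    rw [← htrue, Category.assoc, Category.assoc, hinv, reassoc_of% hcc']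
    exact Category.comp_id _
  · exact htrue

/-- To the points of `DeckSpace` one can attach morphisms of the fundamental groupoid of `M`, from
their images in `M` to a root, in such a way that two points of a copy of a piece have morphisms
which differ by the paths in this piece. -/
theorem exists_deckHom (hT : D.IsArborescent T) :
    ∃ C : FundamentalGroupoid M.space,
      ∃ σ : ∀ y : D.DeckSpace T, FundamentalGroupoid.mk (D.deckProj T y) ⟶ C,
        ∀ x i, ∀ p q : M.space, ∀ (hp : p.1 ∈ (D.piece i).space) (hq : q.1 ∈ (D.piece i).space),
          pieceHom hp hq ≫ σ (D.toDeckSpace T x i ⟨q.1, hq⟩) =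
            σ (D.toDeckSpace T x i ⟨p.1, hp⟩) := by
  obtain ⟨r, t, φ, h⟩ := exists_translationHom hT
  let root (i : ι) (p : M.space) (hp : p.1 ∈ (D.piece i).space) :
      FundamentalGroupoid.mk p ⟶ D.baseObj r := pieceHom hp (basePoint_mem i) ≫ t i
  have hface (p : M.space) (γ b) (hp : p.1 ∈ (D.face γ).space) :
      root (D.side γ (!b)) p (D.face_space_subset γ _ hp) ≫ End.asHom (φ (label T γ b)) =
        root (D.side γ b) p (D.face_space_subset γ _ hp) := by
    dsimp only [root]
    rw [← h γ b p hp, reassoc_of% pieceHom_comp_crossHom (D.face_space_subset γ b hp)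
      (D.face_space_subset γ (!b) hp), Category.assoc]
  have hchain (p : M.space) {i k w} (hw : D.Chain T p.1 i k w) (hi : p.1 ∈ (D.piece i).space)
      (hk : p.1 ∈ (D.piece k).space) : root k p hk ≫ End.asHom (φ w) = root i p hi := by
    induction hw with
    | nil i =>
      rw [map_one]
      exact Category.comp_id _
    | cons γ b hp _ ih =>
      rw [map_mul, End.mul_def, ← Category.assoc, ih (D.face_space_subset γ _ hp) hk,
        hface p γ b hp]
  -- A closed chain gives `root i ≫ φ w = root i`, and `root i` is invertible.
  have hker : D.chainSubgroup T ≤ φ.ker := by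
    refine Subgroup.normalClosure_le_normal ?_
    rintro w ⟨i, p, hp, hw⟩
    have := hchain ⟨p, D.piece_space_subset i hp⟩ hw hp hp
    rw [← Category.comp_id (root i _ hp), Category.assoc, cancel_epi] at this
    exact (Category.id_comp _).symm.trans this
  let ψ : D.Deck T →* End (D.baseObj r) := QuotientGroup.lift _ φ hker
  let σ (y : D.DeckSpace T) : FundamentalGroupoid.mk (D.deckProj T y) ⟶ D.baseObj r :=
    root _ _ (D.mem_pieceAt (D.deckProj T y)) ≫ End.asHom (ψ (D.deckSheet T y))
  have hσ (x i) (p : M.space) (hp : p.1 ∈ (D.piece i).space) :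
      σ (D.toDeckSpace T x i ⟨p.1, hp⟩) = root i p hp ≫ End.asHom (φ x) := by
    obtain ⟨w, hw⟩ := exists_chain T hp (D.mem_pieceAt p)
    have hs : ψ (D.deckSheet T (D.toDeckSpace T x i ⟨p.1, hp⟩)) = φ (x * w) := by
      rw [deckSheet_toDeckSpace]
      exact congrArg (fun c => ψ (x * c)) (hw.transition_eq hp)
    have h₁ : σ (D.toDeckSpace T x i ⟨p.1, hp⟩) =
        root _ p (D.mem_pieceAt p) ≫ End.asHom (φ (x * w)) :=
      congrArg (fun e => root _ p (D.mem_pieceAt p) ≫ End.asHom e) hs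
    rw [h₁, map_mul, End.mul_def, ← hchain p hw hp (D.mem_pieceAt p)]
    exact (Category.assoc _ _ _).symm
  refine ⟨_, σ, fun x i p q hp hq => ?_⟩
  rw [hσ, hσ]
  simp only [root, Category.assoc, reassoc_of% pieceHom_comp hp hq (basePoint_mem i)]

/-- Equal fibre coordinates place `y` in the same copy of a piece as `z`; inside the star, `δ` is
homotopic to a path in that piece. -/
theorem mk_comp_eq_of_mem_star {C : FundamentalGroupoid M.space}
    {σ : ∀ y : D.DeckSpace T, FundamentalGroupoid.mk (D.deckProj T y) ⟶ C}
    (hσ : ∀ x i, ∀ p q : M.space, ∀ (hp : p.1 ∈ (D.piece i).space)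
      (hq : q.1 ∈ (D.piece i).space), pieceHom hp hq ≫ σ (D.toDeckSpace T x i ⟨q.1, hq⟩) =
        σ (D.toDeckSpace T x i ⟨p.1, hp⟩))
    {y z : D.DeckSpace T} {ε : ℝ} (hε₀ : 0 < ε) (hε : IsStarRadius M (D.deckProj T y).1 ε)
    (δ : Path (D.deckProj T y) (D.deckProj T z))
    (hδ : ∀ t, (δ t).1 ∈ Metric.ball (D.deckProj T y).1 ε)
    (hyz : D.fiberCoord T (D.deckProj T y) z = D.fiberCoord T (D.deckProj T y) y) :
    FundamentalGroupoid.fromPath (Path.Homotopic.Quotient.mk δ) ≫ σ z = σ y := by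
  obtain ⟨x, i, q, rfl⟩ := exists_toDeckSpace_eq z
  have hq : q.1 ∈ Metric.ball (D.deckProj T y).1 ε := by simpa using! hδ 1
  have hy : (D.deckProj T y).1 ∈ (D.piece i).space := mem_piece_of_mem_ball hε hq q.2
  have hxy : D.toDeckSpace T x i ⟨_, hy⟩ = y := by
    refine deckSpace_ext_fiberCoord (D.deckProj T y) rfl (Eq.trans ?_ hyz)
    rw [fiberCoord_toDeckSpace hε x i q hq,
      fiberCoord_toDeckSpace hε x i ⟨_, hy⟩ (Metric.mem_ball_self hε₀)]
  obtain ⟨p, hp⟩ : ∃ p : (D.piece i).space, D.toDeckSpace T x i p = y := ⟨_, hxy⟩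
  subst hp
  exact (congrArg (fun e : FundamentalGroupoid.mk (D.incl i p) ⟶ .mk (D.incl i q) =>
    e ≫ σ (D.toDeckSpace T x i q)) (mk_eq_pieceHom p.2 q.2 hε₀ hε δ hδ)).trans
      (hσ x i (D.incl i p) (D.incl i q) p.2 q.2)

theorem mk_map_comp_eq (hM : M.faces.Finite) {C : FundamentalGroupoid M.space}
    {σ : ∀ y : D.DeckSpace T, FundamentalGroupoid.mk (D.deckProj T y) ⟶ C}
    (hσ : ∀ x i, ∀ p q : M.space, ∀ (hp : p.1 ∈ (D.piece i).space)
      (hq : q.1 ∈ (D.piece i).space), pieceHom hp hq ≫ σ (D.toDeckSpace T x i ⟨q.1, hq⟩) =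
        σ (D.toDeckSpace T x i ⟨p.1, hp⟩))
    {y z : D.DeckSpace T} (c : Path y z) :
    FundamentalGroupoid.fromPath (Path.Homotopic.Quotient.mk (c.map continuous_deckProj)) ≫ σ z =
      σ y := by
  set d := c.map continuous_deckProj with hd
  let τ (t : unitInterval) : FundamentalGroupoid.mk (d t) ⟶ C := σ (c t)
  -- Precomposing with the initial part of the path brings all the `τ t` into one fixed Hom-set,
  -- where local constancy makes sense.
  let g (t : unitInterval) : FundamentalGroupoid.mk (d 0) ⟶ C :=
    FundamentalGroupoid.fromPath (Path.Homotopic.Quotient.mk (d.subpath 0 t)) ≫ τ t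
  have hloc : IsLocallyConstant g := by
    refine (IsLocallyConstant.iff_eventually_eq g).2 fun t₀ => ?_
    obtain ⟨ε, hε₀, hε⟩ := exists_isStarRadius hM (d t₀).1
    have hW := ((isOpen_setOf_fiberCoord (T := T) (m := d t₀) hε
      {D.fiberCoord T (d t₀) (c t₀)}).preimage c.continuous).mem_nhds
        ⟨Metric.mem_ball_self hε₀, rfl⟩
    -- For `t` near `t₀` the whole interval between them stays in the open set, so the subpath
    -- remains in the star.
    have huIcc := (tendsto_const_nhds (x := t₀)).uIcc (Filter.tendsto_id (x := 𝓝 t₀))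
    filter_upwards [Filter.tendsto_smallSets_iff.1 huIcc _ hW] with t ht
    have hball (s) : (d.subpath t₀ t s).1 ∈ Metric.ball (d t₀).1 ε := by
      have hs : d.subpath t₀ t s ∈ d '' Set.uIcc t₀ t := by
        rw [← Path.range_subpath]
        exact Set.mem_range_self s
      obtain ⟨u, hu, hus⟩ := hs
      rw [← hus]
      exact (ht hu).1
    have hstep : FundamentalGroupoid.fromPath (Path.Homotopic.Quotient.mk (d.subpath t₀ t)) ≫ τ t =
        τ t₀ :=
      mk_comp_eq_of_mem_star hσ hε₀ hε (d.subpath t₀ t) hball (ht Set.right_mem_uIcc).2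
    have hcomp : FundamentalGroupoid.fromPath (Path.Homotopic.Quotient.mk (d.subpath 0 t₀)) ≫
        FundamentalGroupoid.fromPath (Path.Homotopic.Quotient.mk (d.subpath t₀ t)) =
        FundamentalGroupoid.fromPath (Path.Homotopic.Quotient.mk (d.subpath 0 t)) :=
      Path.Homotopic.Quotient.eq.2 ⟨Path.Homotopy.subpathTransSubpath d 0 t₀ t⟩
    dsimp only [g]
    rw [← hstep, ← Category.assoc, hcomp]
  have hg : g 1 = g 0 := hloc.apply_eq_of_preconnectedSpace 1 0
  have hcast {y' z' : D.DeckSpace T} (hy : y' = y) (hz : z' = z)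
      (h : FundamentalGroupoid.fromPath (Path.Homotopic.Quotient.mk
        (d.cast (congrArg (D.deckProj T) hy) (congrArg (D.deckProj T) hz))) ≫ σ z' = σ y') :
      FundamentalGroupoid.fromPath (Path.Homotopic.Quotient.mk d) ≫ σ z = σ y := by
    subst hy hz
    exact h
  refine hcast c.source c.target (Eq.trans ?_ (hg.trans ?_))
  · dsimp only [g]
    rw [Path.subpath_zero_one]
    rfl
  · dsimp only [g]
    rw [Path.subpath_self]
    exact Category.id_comp _

theorem pathConnectedSpace_deckSpace (hT : D.IsArborescent T) :
    PathConnectedSpace (D.DeckSpace T) := by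
  obtain ⟨r⟩ := hT.2.connected.nonempty
  have hpiece (x : GBar T) (i : ι) (p q : (D.piece i).space) :
      Joined (D.toDeckSpace T x i p) (D.toDeckSpace T x i q) :=
    (PathConnectedSpace.joined p q).map (continuous_toDeckSpace x i)
  have key (x : GBar T) (i : ι) (p : (D.piece i).space) :
      Joined (D.toDeckSpace T 1 r (Classical.arbitrary _)) (D.toDeckSpace T x i p) := by
    rw [← one_mul x]
    refine hT.propagate (P := fun x i => ∀ p, Joined (D.toDeckSpace T 1 r (Classical.arbitrary _))
      (D.toDeckSpace T x i p)) (fun x γ b h p => ?_) (hpiece 1 r _) x i p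
    obtain ⟨q, hq⟩ := (D.face_connected γ).nonempty
    refine Joined.trans ?_ (hpiece _ _ ⟨q, D.face_space_subset γ _ hq⟩ p)
    rw [toDeckSpace, toDeckSpace, ← toTotal_label x γ b hq (D.face_space_subset γ b hq)]
    exact h _
  refine ⟨⟨D.toDeckSpace T 1 r (Classical.arbitrary _)⟩, fun y z => ?_⟩
  obtain ⟨x, i, p, rfl⟩ := exists_toDeckSpace_eq y
  obtain ⟨x', k, q, rfl⟩ := exists_toDeckSpace_eq z
  exact (key x i p).symm.trans (key x' k q)

theorem simplyConnectedSpace_deckSpace [Finite ι] (hT : D.IsArborescent T)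
    (hM : M.faces.Finite) : SimplyConnectedSpace (D.DeckSpace T) := by
  obtain ⟨C, σ, hσ⟩ := exists_deckHom hT
  refine simply_connected_iff_paths_homotopic'.2
    ⟨pathConnectedSpace_deckSpace hT, fun {y z} c d => Path.Homotopic.Quotient.eq.1 ?_⟩
  refine (isCoveringMap_deckProj hM).injective_path_homotopic_map y z ?_
  have h := (mk_map_comp_eq hM hσ c).trans (mk_map_comp_eq hM hσ d).symm
  exact (cancel_mono (σ z)).1 h

theorem isUniversalCovering_deckProj [Finite ι] (hT : D.IsArborescent T)
    (hM : M.faces.Finite) : IsUniversalCovering (D.deckProj T) :=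
  ⟨isCoveringMap_deckProj hM, surjective_deckProj, simplyConnectedSpace_deckSpace hT hM⟩

theorem isLeast_deckRel [Finite ι] (hT : D.IsArborescent T) (hM : M.faces.Finite) :
    IsLeast (KillingRelations (D.F T) (D.cell T) (D.cellInt T)) (D.deckRel T) :=
  ⟨deckRel_mem_killingRelations hM, fun _ hR => deckRel_le hT hM hR⟩

theorem psiF_eq_deckRel [Finite ι] (hT : D.IsArborescent T) (hM : M.faces.Finite) :
    D.PsiF T = D.deckRel T :=
  (isLeast_deckRel hT hM).csInf_eq

end Monodromy

end PieceDecomposition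

end Zipping

end

theorem lemma6 {E : Type*} [NormedAddCommGroup E] [NormedSpace ℝ E]
    (M : Geometry.SimplicialComplex ℝ E) (hM : M.faces.Finite)
    {ι Γ : Type*} [Finite ι] [Finite Γ]
    (D : Zipping.PieceDecomposition M ι Γ) (T : Set Γ) (hT : D.IsArborescent T) :
    IsLeast (Zipping.KillingRelations (D.F T) (D.cell T) (D.cellInt T)) (D.PsiF T) ∧
      Zipping.IsUniversalCovering (D.F₁ T) := by
  -- The type of `F₁` depends on the relation, so the equality with `deckRel` is substituted for a
  -- general `R`.
  have hcov (R : Setoid (D.Total T)) (h : R ≤ Zipping.Phi (D.F T)) (hR : R = D.deckRel T) :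
      Zipping.IsUniversalCovering (Zipping.descend (D.F T) R h) := by
    subst hR
    exact Zipping.PieceDecomposition.isUniversalCovering_deckProj hT hM
  have hΨ := Zipping.PieceDecomposition.psiF_eq_deckRel hT hM
  exact ⟨hΨ ▸ Zipping.PieceDecomposition.isLeast_deckRel hT hM, hcov _ _ hΨ⟩
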